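/- Let $\mathbb T=\{z\in\mathbb C:|z|=1\}$ be the circle group, $\mu_{\mathbb T}$ its Haar measure with $\mu_{\mathbb T}(\mathbb T)=1$, and $L^2(\mathbb T)$ the complex Hilbert space of square integrable functions for $\mu_{\mathbb T}$. For $b\in\mathbb T$ and $f\in L^2(\mathbb T)$ let $\delta_b\ast f$ be the translate $z\mapsto f(b^{-1}z)$. For $b\in\mathbb T$ and $\nu\in\mathbb R$ put $b^{\nu}=e^{it\nu}$, where $t$ is the unique number in $[0,2\pi)$ with $b=e^{it}$. Given $\alpha,\beta\in\mathbb Z$, a (complex) linear form $L:L^2(\mathbb T)\to\mathbb C$, not assumed continuous, is called $(\alpha,\beta)$-invariant if, for all $b\in\mathbb T$ and $f\in L^2(\mathbb T)$, \[L\left[b^{(\alpha+\beta)/2}\,\delta_b\ast f+b^{-(\alpha+\beta)/2}\,\delta_{b^{-1}}\ast f\right]=\bigl(b^{(\alpha-\beta)/2}+b^{-(\alpha-\beta)/2}\bigr)L(f),\] and translation invariant if $L(\delta_b\ast f)=L(f)$ for all $b\in\mathbb T$ and $f\in L^2(\mathbb T)$. Theorem. Let $\alpha,\beta\in\mathbb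 Z$ and let $L$ be a linear form on $L^2(\mathbb T)$. Then the following hold. (i) If $L$ is $(\alpha,\beta)$-invariant, then $L$ is continuous on $L^2(\mathbb T)$; thus there is $h\in L^2(\mathbb T)$ such that $L(f)=\int_{\mathbb T}f\,\overline h\,d\mu_{\mathbb T}$ for all $f\in L^2(\mathbb T)$. (ii) If $h\in L^2(\mathbb T)$, the linear form $f\mapsto\int_{\mathbb T}f\,\overline h\,d\mu_{\mathbb T}$ on $L^2(\mathbb T)$ is $(\alpha,\beta)$-invariant if and only if there are $c_1,c_2\in\mathbb C$ such that $h(z)=c_1z^{\alpha}+c_2z^{\beta}$ for almost all $z\in\mathbb T$. (iii) If $L$ is translation invariant, then $L$ is a multiple of the Haar measure: there is $c\in\mathbb C$ such that $L(f)=c\int_{\mathbb T}f\,d\mu_{\mathbb T}$ for all $f\in L^2(\mathbb T)$. -/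

import Mathlib

open MeasureTheory
open scoped ComplexConjugate

namespace CircleGroup

/-- The circle group carries its Borel σ-algebra. -/
noncomputable instance instMeasurableSpaceCircle : MeasurableSpace Circle := borel Circle

instance instBorelSpaceCircle : BorelSpace Circle := ⟨rfl⟩

/-- The Haar measure on the circle group, normalised to have total mass `1`. -/
noncomputable def haar : Measure Circle := Measure.haarMeasure ⊤

instance instIsHaarMeasureHaar : haar.IsHaarMeasure :=
  inferInstanceAs (Measure.haarMeasure (⊤ : TopologicalSpace.PositiveCompacts Circle)).IsHaarMeasure

instance instIsProbabilityMeasureHaar : IsProbabilityMeasure haar :=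
  ⟨Measure.haarMeasure_self⟩

/-- The complex Hilbert space `L²(𝕋)`. -/
abbrev L2 : Type := Lp ℂ 2 haar

/-- The unique `t ∈ [0, 2π)` with `z = exp (i t)`. -/
noncomputable def angle (z : Circle) : ℝ :=
  toIcoMod Real.two_pi_pos 0 (Complex.arg (z : ℂ))

theorem angle_mem (z : Circle) : angle z ∈ Set.Ico 0 (2 * Real.pi) := by
  simpa [angle] using toIcoMod_mem_Ico Real.two_pi_pos 0 (Complex.arg (z : ℂ))

theorem exp_angle (z : Circle) : Circle.exp (angle z) = z := by
  rw [angle, toIcoMod, Circle.exp_sub]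
  simp [Circle.exp_arg]

/-- The power `z ^ ν = exp (i t ν)`, where `z = exp (i t)` with `t ∈ [0, 2π)`. -/
noncomputable def branchPow (z : Circle) (ν : ℝ) : ℂ :=
  Complex.exp (Complex.I * (angle z : ℂ) * (ν : ℂ))

/-- The convolution `δ_b ∗ f`, that is, the translate `z ↦ f (b⁻¹ z)` of `f ∈ L²(𝕋)`. -/
noncomputable def diracConv (b : Circle) (f : L2) : L2 :=
  Lp.compMeasurePreserving (fun z : Circle => b⁻¹ * z) (measurePreserving_mul_left haar b⁻¹) f

/-- `L` is `(α, β)`-invariant: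
`L [(b^((α+β)/2) δ_b + b^(-(α+β)/2) δ_{b⁻¹}) ∗ f] = (b^((α-β)/2) + b^(-(α-β)/2)) L f`
for all `b ∈ 𝕋` and `f ∈ L²(𝕋)`. -/
def IsInvariant (α β : ℤ) (L : L2 →ₗ[ℂ] ℂ) : Prop :=
  ∀ (b : Circle) (f : L2),
    L (branchPow b (((α : ℝ) + β) / 2) • diracConv b f
        + branchPow b (-(((α : ℝ) + β) / 2)) • diracConv b⁻¹ f)
      = (branchPow b (((α : ℝ) - β) / 2) + branchPow b (-(((α : ℝ) - β) / 2))) * L f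

/-- `L` is translation invariant: `L (δ_b ∗ f) = L f` for all `b ∈ 𝕋` and `f ∈ L²(𝕋)`. -/
def IsTranslationInvariant (L : L2 →ₗ[ℂ] ℂ) : Prop :=
  ∀ (b : Circle) (f : L2), L (diracConv b f) = L f

theorem integral_mul_conj_eq_inner (h f : L2) :
    ∫ z, f z * conj (h z) ∂haar = inner ℂ h f := by
  simp [L2.inner_def, RCLike.inner_apply]

/-- The linear form `f ↦ ∫ f h̄` on `L²(𝕋)` given by `h ∈ L²(𝕋)`. -/
noncomputable def integralForm (h : L2) : L2 →ₗ[ℂ] ℂ where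
  toFun f := ∫ z, f z * conj (h z) ∂haar
  map_add' f g := by
    simp only [integral_mul_conj_eq_inner, inner_add_right]
  map_smul' c f := by
    simp only [integral_mul_conj_eq_inner, inner_smul_right, RingHom.id_apply, smul_eq_mul]

end CircleGroup

/-! After division by `b ^ ((α + β) / 2)`, invariance says that `L` kills the range of every
`differenceOp α β b`, a Fourier multiplier with symbol `b ^ (-n) (1 - b ^ (n - α)) (1 - b ^ (n -
β))`. It suffices to show that every `f` with vanishing coefficients at `α` and `β` is a finite sum
of such differences (`exists_eq_sum_differenceOp`). Then `L f` depends only on two Fourier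
coefficients, and continuity and the form of `h` follow together.

With symbols `m j` for points `b j`, the equation `f = ∑ j, differenceOp α β (b j) (g j)` is
solvable in `L²` once `∑ n, |coeff f n|² / ∑ j, |m j n|²` is finite. Small denominators are handled
by averaging over `b`: since `z ↦ z ^ n` preserves Haar measure for `n ≠ 0`, the integral of
`|symbol| ^ (-1/4)` over `b` is bounded uniformly in `n ≠ α, β`. Hence suitable points, depending on
`f`, exist. -/

namespace CircleGroup

/-! ### Fourier basis of `L²(𝕋)` -/

/-- The monomial `z ↦ z ^ n` as a continuous function on the circle. -/
noncomputable def monomial (n : ℤ) : C(Circle, ℂ) where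
  toFun z := ((z ^ n : Circle) : ℂ)
  continuous_toFun := continuous_induced_dom.comp (continuous_zpow n)

theorem monomial_apply (n : ℤ) (z : Circle) : monomial n z = (z : ℂ) ^ n := by
  simp [monomial]

theorem monomial_add (m n : ℤ) (z : Circle) :
    monomial (m + n) z = monomial m z * monomial n z := by
  simp [monomial, zpow_add]

theorem conj_monomial (n : ℤ) (z : Circle) : conj (monomial n z) = monomial (-n) z := by
  simp [monomial, ← Circle.coe_inv_eq_conj]

/-- The star subalgebra of `C(𝕋, ℂ)` generated by the monomials. -/
noncomputable def monomialSubalgebra : StarSubalgebra ℂ C(Circle, ℂ) where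
  toSubalgebra := Algebra.adjoin ℂ (Set.range monomial)
  star_mem' := by
    change Algebra.adjoin ℂ (Set.range monomial) ≤ star (Algebra.adjoin ℂ (Set.range monomial))
    refine Algebra.adjoin_le ?_
    rintro - ⟨n, rfl⟩
    exact Algebra.subset_adjoin ⟨-n, ContinuousMap.ext fun z => (conj_monomial n z).symm⟩

theorem monomialSubalgebra_toSubmodule :
    Subalgebra.toSubmodule monomialSubalgebra.toSubalgebra
      = Submodule.span ℂ (Set.range monomial) := by
  apply Algebra.adjoin_eq_span_of_subset
  refine Set.Subset.trans ?_ Submodule.subset_span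
  intro x hx
  refine Submonoid.closure_induction (fun _ => id) ⟨0, ?_⟩ ?_ hx
  · ext1 z
    simp [monomial_apply]
  · rintro - - - - ⟨m, rfl⟩ ⟨n, rfl⟩
    exact ⟨m + n, ContinuousMap.ext fun z => monomial_add m n z⟩

theorem monomialSubalgebra_separatesPoints :
    monomialSubalgebra.toSubalgebra.SeparatesPoints := by
  intro x y hxy
  refine ⟨_, ⟨monomial 1, Algebra.subset_adjoin ⟨1, rfl⟩, rfl⟩, ?_⟩
  simpa [monomial_apply, Circle.coe_inj] using hxy

/-- Trigonometric polynomials are uniformly dense in the continuous functions on the circle. -/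
theorem span_monomial_closure_eq_top :
    (Submodule.span ℂ (Set.range monomial)).topologicalClosure = ⊤ := by
  rw [← monomialSubalgebra_toSubmodule]
  exact congr_arg (Subalgebra.toSubmodule <| StarSubalgebra.toSubalgebra ·)
    (ContinuousMap.starSubalgebra_topologicalClosure_eq_top_of_separatesPoints monomialSubalgebra
      monomialSubalgebra_separatesPoints)

/-- The monomial `z ↦ z ^ n` as an element of `L²(𝕋)`. -/
noncomputable def monomialLp (n : ℤ) : L2 := ContinuousMap.toLp 2 haar ℂ (monomial n)

theorem coeFn_monomialLp (n : ℤ) : monomialLp n =ᵐ[haar] monomial n :=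
  ContinuousMap.coeFn_toLp haar (monomial n)

theorem span_monomialLp_closure_eq_top :
    (Submodule.span ℂ (Set.range monomialLp)).topologicalClosure = ⊤ := by
  convert!
    (ContinuousMap.toLp_denseRange ℂ haar ℂ (p := 2) (by simp)).topologicalClosure_map_submodule
      span_monomial_closure_eq_top
  rw [Submodule.map_span, ← Set.range_comp]
  rfl

theorem zpow_surjective {n : ℤ} (hn : n ≠ 0) : Function.Surjective fun z : Circle => z ^ n := by
  intro z
  refine ⟨Circle.exp (angle z / n), ?_⟩
  have hn' : (n : ℝ) ≠ 0 := by exact_mod_cast hn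
  have h := exp_angle z
  dsimp only
  rw [← Circle.exp_zsmul, zsmul_eq_mul, mul_div_cancel₀ _ hn', h]

theorem measurePreserving_zpow {n : ℤ} (hn : n ≠ 0) :
    MeasurePreserving (fun z : Circle => z ^ n) haar haar :=
  (zpowGroupHom n : Circle →* Circle).measurePreserving (continuous_zpow n) (zpow_surjective hn)
    rfl

theorem integral_monomial_of_ne_zero {n : ℤ} (hn : n ≠ 0) : ∫ z, monomial n z ∂haar = 0 := by
  obtain ⟨w, hw⟩ := zpow_surjective hn (-1)
  -- Translation by `w` with `w ^ n = -1` changes the sign of the integrand.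
  refine integral_eq_zero_of_mul_left_eq_neg (g := w) fun z => ?_
  have : (w : ℂ) ^ n = -1 := by simpa using congrArg (fun z : Circle => (z : ℂ)) hw
  simp [monomial_apply, mul_zpow, this]

theorem orthonormal_monomialLp : Orthonormal ℂ monomialLp := by
  rw [orthonormal_iff_ite]
  intro i j
  rw [monomialLp, monomialLp, ContinuousMap.inner_toLp haar (monomial i) (monomial j)]
  simp_rw [conj_monomial, ← monomial_add]
  split_ifs with h
  · simp [h, monomial_apply]
  · exact integral_monomial_of_ne_zero (by omega)

/-- The Hilbert basis of `L²(𝕋)` given by the monomials. -/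
noncomputable def monomialBasis : HilbertBasis ℤ ℂ L2 :=
  HilbertBasis.mk orthonormal_monomialLp span_monomialLp_closure_eq_top.ge

theorem monomialBasis_apply (n : ℤ) : monomialBasis n = monomialLp n := by
  simp [monomialBasis]

/-- The `n`-th Fourier coefficient of `f`. -/
noncomputable def coeff (f : L2) (n : ℤ) : ℂ := inner ℂ (monomialLp n) f

theorem coeff_eq_repr (f : L2) (n : ℤ) : coeff f n = monomialBasis.repr f n := by
  rw [HilbertBasis.repr_apply_apply, monomialBasis_apply, coeff]

theorem ext_coeff {f g : L2} (h : ∀ n, coeff f n = coeff g n) : f = g := by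
  apply monomialBasis.repr.injective
  ext n
  simpa only [coeff_eq_repr] using h n

theorem coeff_monomialLp (m n : ℤ) : coeff (monomialLp m) n = if n = m then 1 else 0 :=
  orthonormal_iff_ite.mp orthonormal_monomialLp n m

theorem tsum_enorm_coeff_ne_top (f : L2) : ∑' n, ‖coeff f n‖ₑ ^ 2 ≠ ⊤ := by
  have h : Summable fun n => ‖coeff f n‖ ^ 2 := by
    have := (memℓp_gen_iff (p := 2) (by simp)).1 (lp.memℓp (monomialBasis.repr f))
    simpa [coeff_eq_repr] using this
  have h2 := h.tsum_ofReal_ne_top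
  simpa [ENNReal.ofReal_pow] using h2

theorem exists_coeff_eq {c : ℤ → ℂ} (hc : ∑' n, ‖c n‖ₑ ^ 2 ≠ ⊤) :
    ∃ g : L2, ∀ n, coeff g n = c n := by
  have h : Summable fun n => ‖c n‖ ^ 2 := by
    have := ENNReal.summable_toReal hc
    simpa using this
  have hmem : Memℓp c 2 := (memℓp_gen_iff (p := 2) (by simp)).2 (by simpa using h)
  refine ⟨monomialBasis.repr.symm ⟨c, hmem⟩, fun n => ?_⟩
  rw [coeff_eq_repr, LinearIsometryEquiv.apply_symm_apply]

theorem coeff_add (f g : L2) (n : ℤ) : coeff (f + g) n = coeff f n + coeff g n :=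
  inner_add_right _ _ _

theorem coeff_sub (f g : L2) (n : ℤ) : coeff (f - g) n = coeff f n - coeff g n :=
  inner_sub_right _ _ _

theorem coeff_smul (c : ℂ) (f : L2) (n : ℤ) : coeff (c • f) n = c * coeff f n :=
  inner_smul_right _ _ _

theorem coeff_sum {ι : Type*} (s : Finset ι) (f : ι → L2) (n : ℤ) :
    coeff (∑ i ∈ s, f i) n = ∑ i ∈ s, coeff (f i) n :=
  inner_sum _ _ _

theorem coeff_eq_integral (f : L2) (n : ℤ) :
    coeff f n = ∫ z, f z * monomial (-n) z ∂haar := by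
  rw [coeff, ← integral_mul_conj_eq_inner]
  refine integral_congr_ae ?_
  filter_upwards [coeFn_monomialLp n] with z hz
  rw [hz, conj_monomial]

theorem coeff_diracConv (b : Circle) (f : L2) (n : ℤ) :
    coeff (diracConv b f) n = (b : ℂ) ^ (-n) * coeff f n := by
  rw [coeff_eq_integral, coeff_eq_integral, ← integral_const_mul]
  have h : ∀ᵐ z ∂haar, diracConv b f z = f (b⁻¹ * z) :=
    Lp.coeFn_compMeasurePreserving f (measurePreserving_mul_left haar b⁻¹)
  rw [← integral_mul_left_eq_self (μ := haar)
    (fun z : Circle => (b : ℂ) ^ (-n) * (f z * monomial (-n) z)) b⁻¹]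
  refine integral_congr_ae ?_
  filter_upwards [h] with z hz
  have hb : (b : ℂ) ≠ 0 := Circle.coe_ne_zero b
  rw [hz, monomial_apply, monomial_apply, Circle.coe_mul, mul_zpow, Circle.coe_inv, inv_zpow]
  field_simp

/-! ### The singular integral `∫ |1 - z| ^ (-1/2)` -/

theorem measurePreserving_toCircle :
    MeasurePreserving (fun x : UnitAddCircle => AddCircle.toCircle x)
      AddCircle.haarAddCircle haar := by
  have hc : Continuous fun x : UnitAddCircle => AddCircle.toCircle x :=
    AddCircle.continuous_toCircle
  have hm := hc.measurable
  refine ⟨hm, ?_⟩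
  set μ := (AddCircle.haarAddCircle (T := 1)).map fun x : UnitAddCircle => AddCircle.toCircle x
    with hμ
  have : IsProbabilityMeasure μ := Measure.isProbabilityMeasure_map hm.aemeasurable
  have : μ.IsMulLeftInvariant := by
    refine ⟨fun g => ?_⟩
    obtain ⟨y, rfl⟩ := (AddCircle.homeomorphCircle (T := 1) one_ne_zero).surjective g
    rw [AddCircle.homeomorphCircle_apply, hμ, Measure.map_map (measurable_const_mul _) hm]
    have : ((fun z : Circle => AddCircle.toCircle y * z) ∘
        fun x : UnitAddCircle => AddCircle.toCircle x)
        = (fun x : UnitAddCircle => AddCircle.toCircle x) ∘ fun x => y + x := by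
      ext x
      simp [AddCircle.toCircle_add]
    rw [this, ← Measure.map_map hm (measurable_const_add _), map_add_left_eq_self]
  have h := Measure.haarMeasure_unique μ (⊤ : TopologicalSpace.PositiveCompacts Circle)
  simpa [haar] using h

/-- The chord has length `2 |sin (π x)|`, and Jordan's inequality bounds the sine below. -/
theorem four_mul_abs_le_norm_one_sub_toCircle {x : ℝ} (hx : |x| ≤ 1 / 2) :
    4 * |x| ≤ ‖1 - (AddCircle.toCircle (x : UnitAddCircle) : ℂ)‖ := by
  have hpi := Real.pi_pos
  have h1 : (AddCircle.toCircle (x : UnitAddCircle) : ℂ)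
      = Complex.exp (Complex.I * ((2 * Real.pi * x : ℝ) : ℂ)) := by
    rw [AddCircle.toCircle_apply_mk, Circle.coe_exp]
    push_cast
    ring_nf
  rw [h1, norm_sub_rev, Complex.norm_exp_I_mul_ofReal_sub_one, Real.norm_eq_abs, abs_mul,
    show 2 * Real.pi * x / 2 = Real.pi * x by ring]
  have h2 : |Real.pi * x| = Real.pi * |x| := by rw [abs_mul, abs_of_pos hpi]
  have h3 := Real.mul_abs_le_abs_sin (x := Real.pi * x) (by rw [h2]; nlinarith)
  rw [h2, show 2 / Real.pi * (Real.pi * |x|) = 2 * |x| by field_simp] at h3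
  rw [abs_two]
  linarith

theorem lintegral_abs_rpow_lt_top :
    ∫⁻ x in Set.Ioc (-(1 / 2) : ℝ) (-(1 / 2) + 1), ‖x‖ₑ ^ (-(1 / 2) : ℝ) < ⊤ := by
  have h0 : IntegrableOn (fun x : ℝ => (x : ℂ) ^ ((-(1 / 2) : ℝ) : ℂ))
      (Set.Ioc (-(1 / 2) : ℝ) (-(1 / 2) + 1)) :=
    (intervalIntegrable_iff_integrableOn_Ioc_of_le (by norm_num)).1
      (intervalIntegral.intervalIntegrable_cpow' (by norm_num))
  refine lt_of_eq_of_lt (lintegral_congr_ae (ae_restrict_of_ae ?_)) h0.2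
  -- At `0` the integrands differ: the complex power is `0`, the extended real one is `⊤`.
  filter_upwards [Measure.ae_ne volume (0 : ℝ)] with x hx
  rw [← ofReal_norm, ← ofReal_norm, Complex.norm_cpow_real, Complex.norm_real,
    ENNReal.ofReal_rpow_of_pos (norm_pos_iff.2 hx)]

/-- The value of `∫ |1 - z| ^ (-1/2)`. -/
noncomputable def singularMass : ENNReal :=
  ∫⁻ z : Circle, ‖1 - (z : ℂ)‖ₑ ^ (-(1 / 2) : ℝ) ∂haar

theorem measurable_enorm_one_sub_rpow :
    Measurable fun z : Circle => ‖1 - (z : ℂ)‖ₑ ^ (-(1 / 2) : ℝ) := by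
  have : Continuous fun z : Circle => ‖1 - (z : ℂ)‖ₑ := by fun_prop
  exact this.measurable.pow_const _

theorem singularMass_lt_top : singularMass < ⊤ := by
  rw [singularMass, ← measurePreserving_toCircle.lintegral_comp measurable_enorm_one_sub_rpow]
  have hv : AddCircle.haarAddCircle (T := 1) = volume := by
    simp [AddCircle.volume_eq_smul_haarAddCircle]
  rw [hv, ← UnitAddCircle.lintegral_preimage (-(1 / 2))]
  refine lt_of_le_of_lt (setLIntegral_mono' measurableSet_Ioc fun x hx => ?_)
    lintegral_abs_rpow_lt_top
  have hx' : |x| ≤ 1 / 2 := abs_le.2 ⟨hx.1.le, by linarith [hx.2]⟩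
  have h4 := four_mul_abs_le_norm_one_sub_toCircle hx'
  rw [ENNReal.rpow_neg, ENNReal.rpow_neg]
  refine ENNReal.inv_le_inv.2 (ENNReal.rpow_le_rpow ?_ (by norm_num))
  rw [enorm_le_iff_norm_le, Real.norm_eq_abs]
  linarith [abs_nonneg x]

/-! ### Simultaneous choice of translations -/

/-- By Tonelli the weighted sum has finite integral over `b`, so it is finite for almost every `b`.
-/
theorem exists_tsum_mul_ne_top {ι Ω : Type*} [Countable ι] [MeasurableSpace Ω] {μ : Measure Ω}
    [NeZero μ] {K : ENNReal} (hK : K ≠ ⊤) {w : Ω → ι → ENNReal}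
    (hw : ∀ n, Measurable fun b => w b n)
    {a : ι → ENNReal} (ha : ∑' n, a n ≠ ⊤) (h : ∀ n, a n ≠ 0 → ∫⁻ b, w b n ∂μ ≤ K) :
    ∃ b, ∑' n, a n * w b n ≠ ⊤ := by
  have hfin : ∫⁻ b, ∑' n, a n * w b n ∂μ ≠ ⊤ := by
    rw [lintegral_tsum fun n => ((hw n).const_mul _).aemeasurable]
    refine ne_top_of_le_ne_top (ENNReal.mul_ne_top ha hK) ?_
    rw [← ENNReal.tsum_mul_right]
    refine ENNReal.tsum_le_tsum fun n => ?_
    rw [lintegral_const_mul _ (hw n)]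
    by_cases hn : a n = 0
    · simp [hn]
    · exact mul_le_mul_right (h n hn) _
  have hae := ae_lt_top (Measurable.tsum fun n => (hw n).const_mul (a n)) hfin
  obtain ⟨b, hb⟩ := hae.exists
  exact ⟨b, hb.ne⟩

/-- Points are chosen one at a time, the weights already obtained being absorbed into `a`; this
never enlarges the support of `a`. -/
theorem exists_tsum_mul_prod_ne_top {ι Ω : Type*} [Countable ι] [MeasurableSpace Ω]
    {μ : Measure Ω} [NeZero μ] {K : ENNReal} (hK : K ≠ ⊤) {w : Ω → ι → ENNReal}
    (hw : ∀ n, Measurable fun b => w b n) {a : ι → ENNReal} (ha : ∑' n, a n ≠ ⊤)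
    (h : ∀ n, a n ≠ 0 → ∫⁻ b, w b n ∂μ ≤ K) (k : ℕ) :
    ∃ b : Fin k → Ω, ∑' n, a n * ∏ j, w (b j) n ≠ ⊤ := by
  induction k with
  | zero => exact ⟨Fin.elim0, by simpa using ha⟩
  | succ k ih =>
    obtain ⟨b, hb⟩ := ih
    obtain ⟨b₀, hb₀⟩ := exists_tsum_mul_ne_top hK hw hb fun n hn => h n (left_ne_zero_of_mul hn)
    refine ⟨Fin.snoc b b₀, ?_⟩
    simpa [Fin.prod_univ_castSucc, mul_assoc] using hb₀

/-! ### The second order difference operator -/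

theorem branchPow_add_int (b : Circle) (ν : ℝ) (n : ℤ) :
    branchPow b (ν + n) = branchPow b ν * (b : ℂ) ^ n := by
  have hb : (b : ℂ) = Complex.exp (angle b * Complex.I) := by
    conv_lhs => rw [← exp_angle b]
    exact Circle.coe_exp _
  rw [branchPow, branchPow, hb, ← Complex.exp_int_mul, ← Complex.exp_add]
  push_cast
  ring_nf

/-- The operator `δ_b + b ^ (-(α + β)) δ_{b⁻¹} - (b ^ (-α) + b ^ (-β))`, a product of two
first order differences up to translation. -/
noncomputable def differenceOp (α β : ℤ) (b : Circle) (f : L2) : L2 :=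
  diracConv b f + (b : ℂ) ^ (-(α + β)) • diracConv b⁻¹ f
    - ((b : ℂ) ^ (-α) + (b : ℂ) ^ (-β)) • f

/-- Dividing by the nonzero factor `branchPow b ((α + β) / 2)` leaves only integer powers of `b`, so
the choice of branch disappears. -/
theorem isInvariant_iff (α β : ℤ) (L : L2 →ₗ[ℂ] ℂ) :
    IsInvariant α β L ↔ ∀ b f, L (differenceOp α β b f) = 0 := by
  refine forall₂_congr fun b f => ?_
  have hp : branchPow b (((α : ℝ) + β) / 2) ≠ 0 := Complex.exp_ne_zero _
  have h1 : branchPow b (-(((α : ℝ) + β) / 2))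
      = branchPow b (((α : ℝ) + β) / 2) * (b : ℂ) ^ (-(α + β)) := by
    rw [← branchPow_add_int]
    push_cast
    ring_nf
  have h2 : branchPow b (((α : ℝ) - β) / 2)
      = branchPow b (((α : ℝ) + β) / 2) * (b : ℂ) ^ (-β) := by
    rw [← branchPow_add_int]
    push_cast
    ring_nf
  have h3 : branchPow b (-(((α : ℝ) - β) / 2))
      = branchPow b (((α : ℝ) + β) / 2) * (b : ℂ) ^ (-α) := by
    rw [← branchPow_add_int]
    push_cast
    ring_nf
  rw [h1, h2, h3, differenceOp, ← sub_eq_zero]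
  simp only [map_add, map_sub, map_smul, smul_eq_mul]
  constructor <;> intro h
  · apply mul_left_cancel₀ hp
    linear_combination h
  · linear_combination branchPow b (((α : ℝ) + β) / 2) * h

/-- The Fourier multiplier of `differenceOp`. -/
noncomputable def symbol (α β : ℤ) (b : Circle) (n : ℤ) : ℂ :=
  (b : ℂ) ^ (-n) * ((1 - (b : ℂ) ^ (n - α)) * (1 - (b : ℂ) ^ (n - β)))

theorem coeff_differenceOp (α β : ℤ) (b : Circle) (f : L2) (n : ℤ) :
    coeff (differenceOp α β b f) n = symbol α β b n * coeff f n := by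
  have hb : (b : ℂ) ≠ 0 := Circle.coe_ne_zero b
  rw [differenceOp, symbol, coeff_sub, coeff_add, coeff_smul, coeff_smul, coeff_diracConv,
    coeff_diracConv, Circle.coe_inv, inv_zpow, ← zpow_neg, neg_neg]
  simp only [zpow_sub₀ hb, zpow_neg, zpow_add₀ hb]
  field_simp
  ring

theorem enorm_symbol (α β : ℤ) (b : Circle) (n : ℤ) :
    ‖symbol α β b n‖ₑ
      = ‖1 - ((b ^ (n - α) : Circle) : ℂ)‖ₑ * ‖1 - ((b ^ (n - β) : Circle) : ℂ)‖ₑ := by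
  have h : ‖((b ^ (-n) : Circle) : ℂ)‖ₑ = 1 := by
    rw [← ofReal_norm, Circle.norm_coe, ENNReal.ofReal_one]
  rw [symbol, enorm_mul, enorm_mul, ← Circle.coe_zpow, ← Circle.coe_zpow, ← Circle.coe_zpow, h,
    one_mul]

theorem measurable_enorm_symbol (α β n : ℤ) : Measurable fun b => ‖symbol α β b n‖ₑ := by
  have h (m : ℤ) : Continuous fun b : Circle => ‖1 - ((b ^ m : Circle) : ℂ)‖ₑ :=
    (continuous_const.sub (monomial m).continuous).enorm
  simp_rw [enorm_symbol]
  exact (h _).measurable.mul (h _).measurable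

theorem lintegral_enorm_one_sub_zpow {n : ℤ} (hn : n ≠ 0) :
    ∫⁻ z : Circle, ‖1 - ((z ^ n : Circle) : ℂ)‖ₑ ^ (-(1 / 2) : ℝ) ∂haar = singularMass :=
  (measurePreserving_zpow hn).lintegral_comp measurable_enorm_one_sub_rpow

theorem mul_le_sq_add_sq (x y : ENNReal) : x * y ≤ x ^ 2 + y ^ 2 := by
  rcases le_total x y with h | h
  · exact (mul_le_mul_left h y).trans (by rw [← sq]; exact le_add_self)
  · exact (mul_le_mul_right h x).trans (by rw [← sq]; exact le_self_add)

/-- The inequality `x y ≤ x² + y²` separates the two factors of the symbol and turns the exponent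
`-1/4` into the integrable `-1/2`. -/
theorem lintegral_enorm_symbol_rpow_le {α β n : ℤ} (hα : n ≠ α) (hβ : n ≠ β) :
    ∫⁻ b, ‖symbol α β b n‖ₑ ^ (-(1 / 4) : ℝ) ∂haar ≤ singularMass + singularMass := by
  have hsq (x : ENNReal) : (x ^ (-(1 / 4) : ℝ)) ^ 2 = x ^ (-(1 / 2) : ℝ) := by
    rw [← ENNReal.rpow_natCast, ← ENNReal.rpow_mul]
    norm_num
  have hm : Measurable fun b : Circle =>
      ‖1 - ((b ^ (n - α) : Circle) : ℂ)‖ₑ ^ (-(1 / 2) : ℝ) :=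
    (continuous_const.sub (monomial (n - α)).continuous).enorm.measurable.pow_const _
  rw [← lintegral_enorm_one_sub_zpow (sub_ne_zero.2 hα)]
  nth_rewrite 2 [lintegral_enorm_one_sub_zpow (sub_ne_zero.2 hα)]
  rw [← lintegral_enorm_one_sub_zpow (sub_ne_zero.2 hβ), ← lintegral_add_left hm]
  refine lintegral_mono fun b => ?_
  rw [enorm_symbol, ENNReal.mul_rpow_of_ne_top enorm_ne_top enorm_ne_top, ← hsq, ← hsq]
  exact mul_le_sq_add_sq _ _

/-! ### Functions whose `α`-th and `β`-th coefficients vanish -/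

/-- The sum dominates each `x j ^ 2`; split its inverse into `k` equal powers and bound each by a
different `j`. -/
theorem inv_sum_sq_le_prod_rpow {k : ℕ} (hk : k ≠ 0) (x : Fin k → ENNReal) :
    (∑ j, x j ^ 2)⁻¹ ≤ ∏ j, x j ^ (-(2 / k) : ℝ) := by
  have hk' : (k : ℝ) ≠ 0 := by exact_mod_cast hk
  calc (∑ j, x j ^ 2)⁻¹ = ∏ _j : Fin k, (∑ j, x j ^ 2) ^ (-(1 / k) : ℝ) := by
        rw [Finset.prod_const, Finset.card_univ, Fintype.card_fin, ← ENNReal.rpow_natCast,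
          ← ENNReal.rpow_mul, neg_mul, one_div_mul_cancel hk', ENNReal.rpow_neg_one]
    _ ≤ _ := by
        refine Finset.prod_le_prod' fun j _ => ?_
        have hx : x j ^ (-(2 / k) : ℝ) = (x j ^ 2) ^ (-(1 / k) : ℝ) := by
          rw [← ENNReal.rpow_natCast, ← ENNReal.rpow_mul]
          congr 1
          push_cast
          ring
        rw [hx, ENNReal.rpow_neg, ENNReal.rpow_neg]
        refine ENNReal.inv_le_inv.2 (ENNReal.rpow_le_rpow ?_ (by positivity))
        exact Finset.single_le_sum (f := fun j => x j ^ 2) (fun _ _ => zero_le)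
          (Finset.mem_univ j)

/-- Eight points are used because `2 / 8 = 1 / 4` is the exponent whose integral is controlled. -/
theorem exists_eq_sum_differenceOp {α β : ℤ} {f : L2} (hα : coeff f α = 0)
    (hβ : coeff f β = 0) :
    ∃ (b : Fin 8 → Circle) (g : Fin 8 → L2), f = ∑ j, differenceOp α β (b j) (g j) := by
  obtain ⟨b, hb⟩ := exists_tsum_mul_prod_ne_top (μ := haar)
    (w := fun b n => ‖symbol α β b n‖ₑ ^ (-(1 / 4) : ℝ))
    (ENNReal.add_ne_top.2 ⟨singularMass_lt_top.ne,
      singularMass_lt_top.ne⟩)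
    (fun n => (measurable_enorm_symbol α β n).pow_const _) (tsum_enorm_coeff_ne_top f)
    (fun n hn => lintegral_enorm_symbol_rpow_le (by rintro rfl; simp [hα] at hn)
      (by rintro rfl; simp [hβ] at hn)) 8
  let m (j : Fin 8) (n : ℤ) : ℂ := symbol α β (b j) n
  let S (n : ℤ) : ℝ := ∑ j, ‖m j n‖ ^ 2
  have hSnn (n : ℤ) : 0 ≤ S n := Finset.sum_nonneg fun _ _ => sq_nonneg _
  have hSe (n : ℤ) : ENNReal.ofReal (S n) = ∑ j, ‖m j n‖ₑ ^ 2 := by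
    rw [ENNReal.ofReal_sum_of_nonneg fun _ _ => sq_nonneg _]
    simp [ENNReal.ofReal_pow]
  have hmS (j : Fin 8) (n : ℤ) : ‖m j n‖ ^ 2 ≤ S n :=
    Finset.single_le_sum (f := fun j => ‖m j n‖ ^ 2) (fun _ _ => sq_nonneg _) (Finset.mem_univ j)
  have hS : ∑' n, ‖coeff f n‖ₑ ^ 2 * (ENNReal.ofReal (S n))⁻¹ ≠ ⊤ := by
    refine ne_top_of_le_ne_top hb (ENNReal.tsum_le_tsum fun n => ?_)
    refine mul_le_mul_right ?_ _
    rw [hSe]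
    refine (inv_sum_sq_le_prod_rpow (by norm_num) fun j => ‖m j n‖ₑ).trans_eq ?_
    norm_num [m]
  -- Where all symbols vanish, a nonzero coefficient would contribute an infinite term.
  have hS0 (n : ℤ) (h0 : S n = 0) : coeff f n = 0 := by
    by_contra hne
    refine ENNReal.ne_top_of_tsum_ne_top hS n ?_
    simp [h0, hne, ENNReal.mul_top]
  -- The least-norm solution of `∑ j, m j n * coeff (g j) n = coeff f n`; it is `0` where `S n = 0`.
  have hg (j : Fin 8) : ∃ g : L2, ∀ n, coeff g n = coeff f n * conj (m j n) / S n := by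
    refine exists_coeff_eq (ne_top_of_le_ne_top hS (ENNReal.tsum_le_tsum fun n => ?_))
    rcases (hSnn n).eq_or_lt with h0 | hpos
    · simp [← h0]
    · rw [← ofReal_norm, ← ofReal_norm, ← ENNReal.ofReal_inv_of_pos hpos,
        ← ENNReal.ofReal_pow (norm_nonneg _), ← ENNReal.ofReal_pow (norm_nonneg _),
        ← ENNReal.ofReal_mul (by positivity)]
      refine ENNReal.ofReal_le_ofReal ?_
      rw [norm_div, norm_mul, RCLike.norm_conj, Complex.norm_real, Real.norm_of_nonneg hpos.le,
        div_pow, mul_pow, ← div_eq_mul_inv, div_le_div_iff₀ (by positivity) hpos]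
      have := mul_le_mul_of_nonneg_left (hmS j n) (by positivity : 0 ≤ ‖coeff f n‖ ^ 2 * S n)
      nlinarith
  choose g hg using hg
  refine ⟨b, g, ext_coeff fun n => ?_⟩
  simp_rw [coeff_sum, coeff_differenceOp, hg]
  by_cases h0 : S n = 0
  · simp [hS0 n h0]
  · have h0' : (S n : ℂ) ≠ 0 := by exact_mod_cast h0
    have hsum : ∑ j, m j n * conj (m j n) = (S n : ℂ) := by
      simp [S, Complex.mul_conj, Complex.normSq_eq_norm_sq]
    calc coeff f n = (∑ j, m j n * conj (m j n)) * (coeff f n / S n) := by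
          rw [hsum]; field_simp
      _ = _ := by
          rw [Finset.sum_mul]
          exact Finset.sum_congr rfl fun j _ => by ring

/-! ### Invariant linear forms -/

/-- Removing the `α` and `β` components of `f` leaves a sum of differences, which `L` kills. The
finset `{α, β}` avoids double counting when `α = β`. -/
theorem IsInvariant.eq_inner {α β : ℤ} {L : L2 →ₗ[ℂ] ℂ} (hL : IsInvariant α β L) (f : L2) :
    L f = inner ℂ (∑ n ∈ {α, β}, conj (L (monomialLp n)) • monomialLp n) f := by
  rw [isInvariant_iff] at hL
  let P : L2 := ∑ n ∈ ({α, β} : Finset ℤ), coeff f n • monomialLp n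
  have hP (n : ℤ) (hn : n ∈ ({α, β} : Finset ℤ)) : coeff (f - P) n = 0 := by
    simp only [P, coeff_sub, coeff_sum, coeff_smul, coeff_monomialLp, mul_ite, mul_one, mul_zero,
      Finset.sum_ite_eq, if_pos hn, sub_self]
  obtain ⟨b, g, hbg⟩ := exists_eq_sum_differenceOp (hP α (by simp)) (hP β (by simp))
  have h0 : L (f - P) = 0 := by simp [hbg, hL]
  rw [map_sub, sub_eq_zero] at h0
  rw [h0, sum_inner, map_sum]
  refine Finset.sum_congr rfl fun n _ => ?_
  rw [map_smul, inner_smul_left, Complex.conj_conj, smul_eq_mul, mul_comm]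
  rfl

theorem isInvariant_integralForm_combination {α β : ℤ} {c₁ c₂ : ℂ} :
    IsInvariant α β (integralForm (c₁ • monomialLp α + c₂ • monomialLp β)) := by
  rw [isInvariant_iff]
  intro b f
  change ∫ z, _ ∂haar = 0
  have h1 := coeff_differenceOp α β b f α
  have h2 := coeff_differenceOp α β b f β
  rw [coeff, symbol] at h1 h2
  rw [integral_mul_conj_eq_inner, inner_add_left, inner_smul_left, inner_smul_left, h1, h2]
  simp

theorem coeFn_combination (α β : ℤ) (c₁ c₂ : ℂ) :
    ∀ᵐ z ∂haar, (c₁ • monomialLp α + c₂ • monomialLp β : L2) z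
      = c₁ * (z : ℂ) ^ α + c₂ * (z : ℂ) ^ β := by
  filter_upwards [Lp.coeFn_add (c₁ • monomialLp α) (c₂ • monomialLp β),
    Lp.coeFn_smul c₁ (monomialLp α), Lp.coeFn_smul c₂ (monomialLp β), coeFn_monomialLp α,
    coeFn_monomialLp β] with z h1 h2 h3 h4 h5
  rw [h1, Pi.add_apply, h2, h3, Pi.smul_apply, Pi.smul_apply, h4, h5, monomial_apply,
    monomial_apply, smul_eq_mul, smul_eq_mul]

theorem exists_sum_eq_combination (α β : ℤ) (c : ℤ → ℂ) :
    ∃ c₁ c₂ : ℂ, ∑ n ∈ ({α, β} : Finset ℤ), c n • monomialLp n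
      = c₁ • monomialLp α + c₂ • monomialLp β := by
  by_cases h : α = β
  · exact ⟨c α, 0, by simp [h]⟩
  · exact ⟨c α, c β, Finset.sum_pair h⟩

theorem isInvariant_integralForm_iff (α β : ℤ) (h : L2) :
    IsInvariant α β (integralForm h) ↔
      ∃ c₁ c₂ : ℂ, ∀ᵐ z ∂haar, h z = c₁ * (z : ℂ) ^ α + c₂ * (z : ℂ) ^ β := by
  constructor
  · intro hL
    obtain ⟨c₁, c₂, hc⟩ := exists_sum_eq_combination α β
      fun n => conj (integralForm h (monomialLp n))
    have hh : h = c₁ • monomialLp α + c₂ • monomialLp β := by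
      refine ext_inner_right ℂ fun f => ?_
      rw [← hc, ← hL.eq_inner, ← integral_mul_conj_eq_inner]
      rfl
    exact ⟨c₁, c₂, hh ▸ coeFn_combination α β c₁ c₂⟩
  · rintro ⟨c₁, c₂, hc⟩
    have hh : h = c₁ • monomialLp α + c₂ • monomialLp β := by
      refine Lp.ext ?_
      filter_upwards [hc, coeFn_combination α β c₁ c₂] with z h1 h2
      rw [h1, h2]
    exact hh ▸ isInvariant_integralForm_combination

/-- For `α = β = 0` the operator is `δ_b + δ_{b⁻¹} - 2`, which `L` sends to `0`. -/
theorem IsTranslationInvariant.isInvariant {L : L2 →ₗ[ℂ] ℂ} (hL : IsTranslationInvariant L) :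
    IsInvariant 0 0 L := by
  rw [isInvariant_iff]
  intro b f
  simp only [differenceOp, map_add, map_sub, map_smul, hL b f, hL b⁻¹ f, smul_eq_mul]
  norm_num
  ring

theorem IsTranslationInvariant.eq_integral {L : L2 →ₗ[ℂ] ℂ} (hL : IsTranslationInvariant L)
    (f : L2) : L f = L (monomialLp 0) * ∫ z, f z ∂haar := by
  rw [hL.isInvariant.eq_inner f]
  have h := coeff_eq_integral f 0
  rw [coeff] at h
  simp [inner_smul_left, h, monomial_apply]

end CircleGroup

theorem mainTheorem4 (α β : ℤ) (L : CircleGroup.L2 →ₗ[ℂ] ℂ) :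
    (CircleGroup.IsInvariant α β L →
      Continuous L ∧
        ∃ h : CircleGroup.L2, ∀ f : CircleGroup.L2,
          L f = ∫ z, f z * conj (h z) ∂CircleGroup.haar) ∧
    (∀ h : CircleGroup.L2,
      CircleGroup.IsInvariant α β (CircleGroup.integralForm h) ↔
        ∃ c₁ c₂ : ℂ, ∀ᵐ z ∂CircleGroup.haar,
          h z = c₁ * (z : ℂ) ^ α + c₂ * (z : ℂ) ^ β) ∧
    (CircleGroup.IsTranslationInvariant L →
      ∃ c : ℂ, ∀ f : CircleGroup.L2, L f = c * ∫ z, f z ∂CircleGroup.haar) := by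
  refine ⟨fun hL => ⟨?_, ?_⟩, CircleGroup.isInvariant_integralForm_iff α β,
    fun hL => ⟨_, hL.eq_integral⟩⟩
  · rw [funext hL.eq_inner]
    exact continuous_const.inner continuous_id
  · exact ⟨_, fun f =>
      (hL.eq_inner f).trans (CircleGroup.integral_mul_conj_eq_inner _ f).symm⟩
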